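/- For a digraph $G=(V,E)$ let $G^{\star}$ denote its transitive closure (the pairs $(u,v)$ joined by a directed walk with at least one edge), let $\mathrm{dist}_G(u,v)$ be the number of edges of a shortest directed path from $u$ to $v$, and let the diameter of $G$ be $\max_{(u,v)\in G^{\star}}\mathrm{dist}_G(u,v)$ (and $0$ if $G$ has no edges). A shortcut set for $G$ is a set $H\subseteq G^{\star}$ of edges, and $G\cup H$ is the digraph obtained by adding the edges of $H$ to $G$. For positive integers $n \ge D$ let $S(n,D)$ be the least integer $s$ such that every $n$-vertex digraph $G$ has a shortcut set $H$ with $|H|\le s$ for which $G\cup H$ has diameter at most $D$. **Theorem (Extended Lower Bound Constructions).** There is an absolute constant $c>0$ such that the following hold. 1. For all integers $n, D$ with $n^{1/6}\le D\le n-1$ there is an $n$-vertex digraph $G$ such that for every shortcut set $H\subseteq G^{\star}$ with $|H|\le c\,(n/D)^{6/5}$ the diameter of $G\cup H$ is at least $D$. 2. Consequently $S(n,D)=\Omega((n/D)^{6/5})$: for all integers $n, D$ with $n^{1/6}\le D\le n-2$ we have $S(n,D)\ge c\,(n/D)^{6/5}$. -/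

import Mathlib

namespace Digraph

/-- `G.HasWalk k u v`: there is a directed walk with exactly `k` edges from `u` to `v` in `G`. -/
inductive HasWalk {V : Type*} (G : Digraph V) : ℕ → V → V → Prop
  | nil (v : V) : HasWalk G 0 v v
  | cons {k : ℕ} {u v w : V} (huv : G.Adj u v) (hvw : HasWalk G k v w) : HasWalk G (k + 1) u w

/-- The number of edges of a shortest directed path from `u` to `v`;
it is `⊤` when `v` is not reachable from `u`. -/
noncomputable def pathDist {V : Type*} (G : Digraph V) (u v : V) : ℕ∞ :=
  ⨅ (k : ℕ) (_ : G.HasWalk k u v), (k : ℕ∞)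

/-- The transitive closure of `G`: `(u, v)` is an edge iff there is a directed walk
from `u` to `v` with at least one edge. -/
def transClosure {V : Type*} (G : Digraph V) : Digraph V where
  Adj := Relation.TransGen G.Adj

/-- The largest distance `dist_G(u, v)` over the pairs `(u, v)` in the transitive closure of `G`
(pairs that are not connected by a directed path are ignored). -/
noncomputable def diameter {V : Type*} (G : Digraph V) : ℕ∞ :=
  ⨆ (u : V) (v : V) (_ : G.transClosure.Adj u v), G.pathDist u v

/-- `H` is a set of shortcut edges for `G`, that is, of edges of the transitive closure of `G`. -/
def IsShortcutSet {V : Type*} (G : Digraph V) (H : Finset (V × V)) : Prop :=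
  ∀ e ∈ H, G.transClosure.Adj e.1 e.2

/-- The digraph `G ∪ H`, obtained from `G` by adding the edges in `H`. -/
def addEdges {V : Type*} (G : Digraph V) (H : Finset (V × V)) : Digraph V where
  Adj u v := G.Adj u v ∨ (u, v) ∈ H

end Digraph

/-- `s` shortcut edges suffice to reduce the diameter of every `n`-vertex digraph
to at most `D`. -/
def ShortcutsSuffice (n D s : ℕ) : Prop :=
  ∀ G : Digraph (Fin n), ∃ H : Finset (Fin n × Fin n),
    G.IsShortcutSet H ∧ H.card ≤ s ∧ (G.addEdges H).diameter ≤ (D : ℕ∞)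

/-- `S(n, D)`: the least number of shortcut edges that suffices to reduce the diameter of every
`n`-vertex digraph to at most `D` (for `D ≥ 1` such a number exists). -/
noncomputable def shortcutNumber (n D : ℕ) : ℕ :=
  sInf {s : ℕ | ShortcutsSuffice n D s}

/-! ### Walks, shortcuts and the directed path -/

namespace Digraph

/-! Stack grids of size 2d² × 2d³ in layers; at each of d block boundaries a path moves by some (a,
a²), a < d, and between boundaries it stands still for k steps. Strict convexity of the parabola
makes rigid each of the d⁶ lines that repeat one direction (i, i²): a walk between two points of a
line cannot leave it, even with shortcuts (`potential_mono_of_transGen`). A shortcut across blocks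
lies on at most one line, one inside a block on at most d lines. Averaging over lines
(`exists_line_few_pairs`), d⁶/2 shortcuts leave a line with no crossing shortcut and at most d/2
inner ones. These spoil at most d/2 of its d blocks, so about kd/2 steps remain
(`le_diameter_parabola`). There are about d⁵·kd vertices; with kd of order D this gives d of order
(n/D)^(1/5), hence (n/D)^(6/5) shortcuts. -/

theorem HasWalk.reflTransGen {V : Type*} {G : Digraph V} {m : ℕ} {u v : V}
    (h : G.HasWalk m u v) : Relation.ReflTransGen G.Adj u v := by
  induction h with
  | nil v => exact .refl
  | cons huv _ ih => exact .head huv ih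

theorem transGen_of_addEdges {V : Type*} {G : Digraph V} {H : Finset (V × V)}
    (hH : G.IsShortcutSet H) {u v : V} (h : (G.addEdges H).Adj u v) :
    Relation.TransGen G.Adj u v := by
  rcases h with h | h
  · exact .single h
  · exact hH _ h

theorem transGen_of_transGen_addEdges {V : Type*} {G : Digraph V} {H : Finset (V × V)}
    (hH : G.IsShortcutSet H) {u v : V} (h : Relation.TransGen (G.addEdges H).Adj u v) :
    Relation.TransGen G.Adj u v :=
  Relation.TransGen.trans_induction_on h (fun h => transGen_of_addEdges hH h)
    (fun _ _ h h' => h.trans h')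

/-- A pair of the transitive closure all of whose connecting walks in `G ∪ H` have at least `D`
edges witnesses that `G ∪ H` has diameter at least `D`. -/
theorem le_diameter_addEdges {V : Type*} {G : Digraph V} {H : Finset (V × V)} {D : ℕ} {s t : V}
    (hst : Relation.TransGen G.Adj s t)
    (hD : ∀ m, (G.addEdges H).HasWalk m s t → D ≤ m) :
    (D : ℕ∞) ≤ (G.addEdges H).diameter := by
  have hst' : (G.addEdges H).transClosure.Adj s t :=
    Relation.TransGen.mono (p := (G.addEdges H).Adj) (fun _ _ h => Or.inl h) s t hst
  refine le_trans ?_ (le_iSup₂_of_le s t (le_iSup_of_le hst' le_rfl))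
  exact le_iInf₂ fun m hm => by exact_mod_cast hD m hm

/-- Adding the whole transitive closure leaves a digraph of diameter at most one. -/
theorem exists_shortcutSet_diameter_le_one {V : Type*} [Fintype V] (G : Digraph V) :
    ∃ H : Finset (V × V), G.IsShortcutSet H ∧ (G.addEdges H).diameter ≤ 1 := by
  classical
  have hH : G.IsShortcutSet (Finset.univ.filter fun e : V × V => G.transClosure.Adj e.1 e.2) :=
    fun e he => (Finset.mem_filter.1 he).2
  refine ⟨_, hH, iSup₂_le fun u v => iSup_le fun huv => ?_⟩
  have huv' : Relation.TransGen G.Adj u v := transGen_of_transGen_addEdges hH huv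
  refine iInf₂_le_of_le 1 (.cons (Or.inr ?_) (.nil v)) (by simp)
  exact Finset.mem_filter.2 ⟨Finset.mem_univ _, huv'⟩

/-- The directed path `0 → 1 → ⋯ → n - 1`. -/
def finPath (n : ℕ) : Digraph (Fin n) where
  Adj u v := (v : ℕ) = u + 1

theorem le_diameter_finPath {n D : ℕ} (hD : 0 < D) (hDn : D < n) :
    (D : ℕ∞) ≤ ((finPath n).addEdges ∅).diameter := by
  refine le_diameter_addEdges (s := ⟨0, by omega⟩) (t := ⟨D, hDn⟩) ?_ ?_
  · have key : ∀ m (hm : m + 1 < n),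
        Relation.TransGen (finPath n).Adj ⟨0, by omega⟩ ⟨m + 1, hm⟩ := by
      intro m
      induction m with
      | zero => exact fun hm => .single rfl
      | succ m ih => exact fun hm => .tail (ih (by omega)) rfl
    obtain ⟨m, rfl⟩ : ∃ m, D = m + 1 := ⟨D - 1, by omega⟩
    exact key m hDn
  · have key : ∀ m u v, ((finPath n).addEdges ∅).HasWalk m u v → (v : ℕ) = u + m := by
      intro m u v h
      induction h with
      | nil v => rfl
      | cons huv _ ih =>
        rcases huv with huv | huv
        · have huv : (_ : ℕ) = _ := huv
          omega
        · simp at huv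
    intro m hm
    have := key _ _ _ hm
    simp only at this
    omega

/-! ### Rigidity of lines in the layered graph -/

section Parabola

/-- Vertices carry a position `q` and grid coordinates `(x, y)`. Every edge advances the position
by one; when it enters a new block of `k` consecutive positions it moves the grid point by
`(a, a ^ 2)` for some `a < d`, and otherwise it keeps the grid point. -/
def parabola {V : Type*} (d k : ℕ) (q x y : V → ℕ) : Digraph V where
  Adj u v := q v = q u + 1 ∧
    if k ∣ q v then ∃ a < d, x v = x u + a ∧ y v = y u + a ^ 2 else x v = x u ∧ y v = y u

/-- The vertex `v` lies on the line through `(b, c)` of direction `(i, i ^ 2)`. -/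
def OnLine {V : Type*} (k : ℕ) (q x y : V → ℕ) (i b c : ℕ) (v : V) : Prop :=
  x v = b + i * (q v / k) ∧ y v = c + i ^ 2 * (q v / k)

/-- A potential that is constant on the lines of direction `(i, i ^ 2)` and that no edge of
`parabola` decreases. -/
def potential {V : Type*} (k : ℕ) (q x y : V → ℕ) (i : ℕ) (v : V) : ℤ :=
  y v - 2 * i * x v + (i : ℤ) ^ 2 * ((q v / k : ℕ) : ℤ)

variable {V : Type*} {d k : ℕ} {q x y : V → ℕ}

theorem OnLine.potential_eq {i b c : ℕ} {v : V} (h : OnLine k q x y i b c v) :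
    potential k q x y i v = c - 2 * i * b := by
  obtain ⟨h1, h2⟩ := h
  rw [potential, h1, h2]
  push_cast
  ring

/-- A boundary move by (a, a²) raises the potential by a² - 2ia + i² = (a - i)², which vanishes only
for the line's own direction a = i; all other edges preserve it. -/
theorem potential_mono_of_transGen (i : ℕ) {u v : V}
    (h : Relation.TransGen (parabola d k q x y).Adj u v) :
    potential k q x y i u ≤ potential k q x y i v ∧
      (potential k q x y i u = potential k q x y i v →
        ∀ b c, OnLine k q x y i b c u → OnLine k q x y i b c v) := by
  refine Relation.TransGen.trans_induction_on h ?_ ?_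
  · rintro u v ⟨hq, hxy⟩
    split_ifs at hxy with hk
    · obtain ⟨a, -, hx, hy⟩ := hxy
      have hL : q v / k = q u / k + 1 := by
        rw [hq] at hk ⊢
        rw [Nat.succ_div, if_pos hk]
      have hdiff : potential k q x y i v = potential k q x y i u + ((a : ℤ) - i) ^ 2 := by
        simp only [potential, hL, hx, hy]
        push_cast
        ring
      refine ⟨by rw [hdiff]; exact le_add_of_nonneg_right (sq_nonneg _), fun he b c hu => ?_⟩
      have ha : ((a : ℤ) - i) ^ 2 = 0 := by linarith
      have ha : a = i := by
        have := pow_eq_zero_iff (two_ne_zero) |>.1 ha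
        omega
      subst ha
      obtain ⟨h1, h2⟩ := hu
      exact ⟨by rw [hx, hL, h1]; ring, by rw [hy, hL, h2]; ring⟩
    · have hL : q v / k = q u / k := by
        rw [hq] at hk ⊢
        rw [Nat.succ_div, if_neg hk, add_zero]
      obtain ⟨hx, hy⟩ := hxy
      simp only [potential, OnLine, hL, hx, hy]
      exact ⟨le_rfl, fun _ _ _ h => h⟩
  · rintro u v w - - ⟨h1, h1'⟩ ⟨h2, h2'⟩
    exact ⟨h1.trans h2, fun he b c hu => h2' (by linarith) b c (h1' (by linarith) b c hu)⟩

/-- If the shortcuts joining two vertices of a line all stay inside a single block that belongs to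
`B`, then a walk between two vertices of the line is at least as long as the number of
positions it passes outside the blocks in `B`. -/
theorem count_le_of_hasWalk_addEdges {H : Finset (V × V)} {i b c : ℕ} {B : Finset ℕ}
    (hH : (parabola d k q x y).IsShortcutSet H)
    (hB : ∀ e ∈ H, OnLine k q x y i b c e.1 → OnLine k q x y i b c e.2 →
      q e.1 / k = q e.2 / k ∧ q e.1 / k ∈ B)
    {m : ℕ} {s t : V} (h : ((parabola d k q x y).addEdges H).HasWalk m s t)
    (hs : OnLine k q x y i b c s) (ht : OnLine k q x y i b c t) :
    Nat.count (fun j => j / k ∉ B) (q t) ≤ Nat.count (fun j => j / k ∉ B) (q s) + m := by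
  induction h with
  | nil v => rfl
  | @cons m u v w huv hvw ih =>
    have h1 := potential_mono_of_transGen i (transGen_of_addEdges hH huv)
    have h2 : potential k q x y i v ≤ potential k q x y i w := by
      rcases Relation.reflTransGen_iff_eq_or_transGen.1 hvw.reflTransGen with h | h
      · rw [h]
      · exact (potential_mono_of_transGen i (transGen_of_transGen_addEdges hH h)).1
    have h3 := hs.potential_eq
    have h4 := ht.potential_eq
    -- The potential at `v` is squeezed between its equal values at the two ends of the line.
    have hv : OnLine k q x y i b c v := h1.2 (by linarith [h1.1]) b c hs
    have hstep : Nat.count (fun j => j / k ∉ B) (q v) ≤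
        Nat.count (fun j => j / k ∉ B) (q u) + 1 := by
      rcases huv with huv | huv
      · rw [huv.1, Nat.count_succ]
        split_ifs <;> omega
      · obtain ⟨he, hmem⟩ := hB _ huv hs hv
        simp only at he hmem
        rcases le_total (q v) (q u) with hle | hle
        · exact (Nat.count_monotone _ hle).trans (Nat.le_succ _)
        -- A forward shortcut stays in one block of `B`, where no position is counted.
        · have : ∀ r, q u + r ≤ q v → Nat.count (fun j => j / k ∉ B) (q u + r) =
              Nat.count (fun j => j / k ∉ B) (q u) := by
            intro r
            induction r with
            | zero => simp
            | succ r ihr =>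
              intro hr
              have hblock : (q u + r) / k = q u / k :=
                le_antisymm (he ▸ Nat.div_le_div_right (by omega))
                  (Nat.div_le_div_right (by omega))
              rw [← add_assoc, Nat.count_succ, if_neg (by rw [hblock]; simpa using hmem),
                add_zero, ihr (by omega)]
          have := this (q v - q u) (by omega)
          rw [Nat.add_sub_cancel' hle] at this
          omega
    have := ih hv ht
    omega

theorem le_count_div_notMem (B : Finset ℕ) {k : ℕ} (hk : 0 < k) (N : ℕ) :
    N ≤ Nat.count (fun j => j / k ∉ B) N + k * B.card := by
  have hle : ((Finset.range N).filter fun j => j / k ∈ B).card ≤ k * B.card := by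
    refine (Finset.card_le_mul_card_image_of_maps_to (f := fun j => j / k) (t := B)
      (fun j hj => (Finset.mem_filter.1 hj).2) k fun a _ => ?_)
    refine (Finset.card_le_card (t := Finset.Ico (a * k) (a * k + k)) fun j hj => ?_).trans
      (by simp)
    have := (Finset.mem_filter.1 hj).2
    have h1 := Nat.div_add_mod j k
    have h2 := Nat.mod_lt j hk
    rw [this, mul_comm] at h1
    exact Finset.mem_Ico.2 ⟨by omega, by omega⟩
  have := Finset.card_filter_add_card_filter_not (s := Finset.range N) (fun j => j / k ∈ B)
  rw [Finset.card_range] at this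
  rw [Nat.count_eq_card_filter_range]
  omega

theorem transGen_parabola (hk : 0 < k) (hd : 0 < d) {i b c : ℕ} (hi : i < d) (p : ℕ → V)
    (hp : ∀ j ≤ k * d, q (p j) = j ∧ OnLine k q x y i b c (p j)) :
    Relation.TransGen (parabola d k q x y).Adj (p 0) (p (k * d)) := by
  have hadj : ∀ j, j + 1 ≤ k * d → (parabola d k q x y).Adj (p j) (p (j + 1)) := by
    intro j hj
    obtain ⟨h1, h2, h3⟩ := hp j (by omega)
    obtain ⟨h1', h2', h3'⟩ := hp (j + 1) hj
    refine ⟨by omega, ?_⟩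
    rw [h1] at h2 h3
    rw [h1'] at h2' h3' ⊢
    rw [Nat.succ_div] at h2' h3'
    split_ifs at h2' h3' ⊢ with hdvd
    · exact ⟨i, hi, by rw [h2, h2']; ring, by rw [h3, h3']; ring⟩
    · exact ⟨by rw [h2, h2', add_zero], by rw [h3, h3', add_zero]⟩
  have key : ∀ j, j + 1 ≤ k * d →
      Relation.TransGen (parabola d k q x y).Adj (p 0) (p (j + 1)) := by
    intro j
    induction j with
    | zero => exact fun hj => .single (hadj 0 hj)
    | succ j ih => exact fun hj => .tail (ih (by omega)) (hadj _ hj)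
  obtain ⟨j, hj⟩ : ∃ j, k * d = j + 1 := ⟨k * d - 1, by have := Nat.mul_pos hk hd; omega⟩
  rw [hj]
  exact key j hj.ge

/-! ### Averaging over the lines -/

open Classical in
/-- A set of at most `d ^ 6 / 2` pairs leaves a line that contains no pair from two different
blocks, and at most `d / 2` pairs inside blocks. -/
theorem exists_line_few_pairs (hd : 0 < d) (H : Finset (V × V)) (hH : 2 * H.card ≤ d ^ 6) :
    ∃ i < d, ∃ b < d ^ 2, ∃ c < d ^ 3,
      (∀ e ∈ H, OnLine k q x y i b c e.1 → OnLine k q x y i b c e.2 → q e.1 / k = q e.2 / k) ∧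
      2 * (H.filter fun e => OnLine k q x y i b c e.1 ∧ OnLine k q x y i b c e.2).card ≤ d := by
  let T := Finset.range d ×ˢ Finset.range (d ^ 2) ×ˢ Finset.range (d ^ 3)
  let on : V × V → ℕ × ℕ × ℕ → Prop := fun e l =>
    OnLine k q x y l.1 l.2.1 l.2.2 e.1 ∧ OnLine k q x y l.1 l.2.1 l.2.2 e.2
  -- With these weights every pair contributes at most `d` in total over all lines, while a single
  -- crossing pair already exceeds the average `d / 2`.
  let w : V × V → ℕ := fun e => if q e.1 / k = q e.2 / k then 1 else d
  have hdet : ∀ e l l', on e l → on e l' → l.1 = l'.1 → l = l' := by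
    rintro e ⟨i, b, c⟩ ⟨i', b', c'⟩ ⟨⟨h1, h2⟩, -⟩ ⟨⟨h1', h2'⟩, -⟩ (rfl : i = i')
    simp only [Prod.mk.injEq, true_and] at *
    omega
  have hcol : ∀ e, ∑ l ∈ T with on e l, w e ≤ d := by
    intro e
    rw [Finset.sum_const, smul_eq_mul]
    by_cases he : q e.1 / k = q e.2 / k
    · simp only [w, if_pos he, mul_one]
      calc (T.filter (on e)).card ≤ (Finset.range d).card := by
            refine Finset.card_le_card_of_injOn Prod.fst (fun l hl => ?_) fun l hl l' hl' h => ?_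
            · exact (Finset.mem_product.1 (Finset.mem_filter.1 hl).1).1
            · exact hdet e l l' (Finset.mem_filter.1 hl).2 (Finset.mem_filter.1 hl').2 h
        _ = d := Finset.card_range d
    · simp only [w, if_neg he]
      suffices (T.filter (on e)).card ≤ 1 by nlinarith
      refine Finset.card_le_one.2 fun l hl l' hl' => ?_
      have h := (Finset.mem_filter.1 hl).2
      have h' := (Finset.mem_filter.1 hl').2
      refine hdet e l l' h h' ?_
      have e1 : (x e.1 : ℤ) = l.2.1 + l.1 * (q e.1 / k : ℕ) := by exact_mod_cast h.1.1
      have e2 : (x e.2 : ℤ) = l.2.1 + l.1 * (q e.2 / k : ℕ) := by exact_mod_cast h.2.1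
      have e3 : (x e.1 : ℤ) = l'.2.1 + l'.1 * (q e.1 / k : ℕ) := by exact_mod_cast h'.1.1
      have e4 : (x e.2 : ℤ) = l'.2.1 + l'.1 * (q e.2 / k : ℕ) := by exact_mod_cast h'.2.1
      -- Two points in different blocks determine the slope of the line in the `x` coordinate.
      have hz : ((l.1 : ℤ) - l'.1) * ((q e.1 / k : ℕ) - (q e.2 / k : ℕ)) = 0 := by linarith
      rcases mul_eq_zero.1 hz with h0 | h0
      · omega
      · exact absurd (by exact_mod_cast sub_eq_zero.1 h0) he
  have htot : ∑ l ∈ T, 2 * ∑ e ∈ H with on e l, w e ≤ ∑ _l ∈ T, d := by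
    rw [← Finset.mul_sum]
    have hswap : ∑ l ∈ T, ∑ e ∈ H with on e l, w e = ∑ e ∈ H, ∑ l ∈ T with on e l, w e := by
      simp only [Finset.sum_filter]
      exact Finset.sum_comm
    rw [hswap]
    have h1 := Finset.sum_le_card_nsmul H _ d fun e _ => hcol e
    have hT : T.card = d ^ 6 := by
      simp only [T, Finset.card_product, Finset.card_range]
      ring
    rw [Finset.sum_const, hT, smul_eq_mul]
    rw [smul_eq_mul] at h1
    nlinarith
  have hTne : T.Nonempty := ⟨(0, 0, 0), by simp [T, hd, pow_pos hd]⟩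
  obtain ⟨⟨i, b, c⟩, hl, hle⟩ := Finset.exists_le_of_sum_le hTne htot
  simp only [T, Finset.mem_product, Finset.mem_range] at hl
  refine ⟨i, hl.1, b, hl.2.1, c, hl.2.2, fun e he h1 h2 => ?_, ?_⟩
  · by_contra hne
    have hw : w e ≤ ∑ e ∈ H with on e (i, b, c), w e :=
      Finset.single_le_sum (f := w) (fun _ _ => Nat.zero_le _)
        (Finset.mem_filter.2 ⟨he, h1, h2⟩)
    simp only [w, if_neg hne] at hw hle
    omega
  · refine le_trans ?_ hle
    refine Nat.mul_le_mul_left 2 ?_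
    rw [Finset.card_eq_sum_ones]
    refine Finset.sum_le_sum fun e _ => ?_
    simp only [w]
    split_ifs <;> omega

/-- If the coordinates cover the box `[0, kd] × [0, 2d²) × [0, 2d³)`, then `d ^ 6 / 2` shortcuts
do not reduce the diameter of `parabola` below `kd / 2`. -/
theorem le_diameter_parabola {D : ℕ} (hk : 0 < k) (hd : 0 < d) (hD : 2 * D ≤ k * d)
    (hsurj : ∀ j ≤ k * d, ∀ a < 2 * d ^ 2, ∀ b < 2 * d ^ 3, ∃ v, q v = j ∧ x v = a ∧ y v = b)
    {H : Finset (V × V)} (hH : (parabola d k q x y).IsShortcutSet H)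
    (hcard : 2 * H.card ≤ d ^ 6) :
    (D : ℕ∞) ≤ ((parabola d k q x y).addEdges H).diameter := by
  classical
  obtain ⟨i, hi, b, hb, c, hc, hcross, hinner⟩ :=
    exists_line_few_pairs (k := k) (q := q) (x := x) (y := y) hd H hcard
  have hex : ∀ j, ∃ v, j ≤ k * d → q v = j ∧ OnLine k q x y i b c v := by
    intro j
    by_cases hj : j ≤ k * d
    · have hL : j / k ≤ d := Nat.div_le_of_le_mul hj
      have h1 : i * (j / k) ≤ d ^ 2 := by rw [sq]; exact Nat.mul_le_mul hi.le hL
      have h2 : i ^ 2 * (j / k) ≤ d ^ 3 := by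
        rw [pow_succ d 2]; exact Nat.mul_le_mul (Nat.pow_le_pow_left hi.le 2) hL
      obtain ⟨v, hv1, hv2, hv3⟩ := hsurj j hj (b + i * (j / k)) (by omega)
        (c + i ^ 2 * (j / k)) (by omega)
      exact ⟨v, fun _ => ⟨hv1, by rw [hv2, hv1], by rw [hv3, hv1]⟩⟩
    · obtain ⟨v, -⟩ := hsurj 0 (Nat.zero_le _) 0 (by positivity) 0 (by positivity)
      exact ⟨v, fun h => absurd h hj⟩
  choose p hp using hex
  refine le_diameter_addEdges (transGen_parabola hk hd hi p hp) fun m hm => ?_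
  let F := H.filter fun e => OnLine k q x y i b c e.1 ∧ OnLine k q x y i b c e.2
  let B := F.image fun e => q e.1 / k
  have hwalk := count_le_of_hasWalk_addEdges (B := B) hH
    (fun e he h1 h2 => ⟨hcross e he h1 h2,
      Finset.mem_image_of_mem (fun e : V × V => q e.1 / k) (Finset.mem_filter.2 ⟨he, h1, h2⟩)⟩) hm
    (hp 0 (Nat.zero_le _)).2 (hp _ le_rfl).2
  rw [(hp 0 (Nat.zero_le _)).1, (hp _ le_rfl).1, Nat.count_zero, zero_add] at hwalk
  have hcount := le_count_div_notMem B hk (k * d)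
  have hBF : 2 * B.card ≤ d := (Nat.mul_le_mul_left 2 Finset.card_image_le).trans hinner
  have := Nat.mul_le_mul_left k hBF
  have h3 : k * (2 * B.card) = 2 * (k * B.card) := by ring
  omega

end Parabola

/-- Mixed radix digits realize `parabola` on every sufficiently large `Fin n`. -/
theorem exists_fin_le_diameter {n d k D : ℕ} (hk : 0 < k) (hd : 0 < d) (hD : 2 * D ≤ k * d)
    (hn : 8 * d ^ 5 * (k * d) ≤ n) :
    ∃ G : Digraph (Fin n), ∀ H : Finset (Fin n × Fin n), G.IsShortcutSet H →
      2 * H.card ≤ d ^ 6 → (D : ℕ∞) ≤ (G.addEdges H).diameter := by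
  refine ⟨parabola d k (fun v => v / (2 * d ^ 2 * (2 * d ^ 3)))
    (fun v => v % (2 * d ^ 2 * (2 * d ^ 3)) / (2 * d ^ 3))
    (fun v => v % (2 * d ^ 3)), fun H hH hcard => le_diameter_parabola hk hd hD ?_ hH hcard⟩
  intro j hj a ha b hb
  have hkd : 1 ≤ k * d := Nat.mul_pos hk hd
  set B := 2 * d ^ 3 with hB
  set A := 2 * d ^ 2 with hA
  have hAB : A * B = 4 * d ^ 5 := by rw [hA, hB]; ring
  have hab : a * B + b < A * B := by nlinarith
  have hlt : j * (A * B) + (a * B + b) < n := by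
    have : (j + 1) * (A * B) ≤ n := by
      rw [hAB]
      nlinarith [pow_pos hd 5]
    nlinarith
  refine ⟨⟨j * (A * B) + (a * B + b), hlt⟩, ?_, ?_, ?_⟩
  · simp only
    rw [mul_comm j, Nat.mul_add_div (by omega), Nat.div_eq_of_lt hab, add_zero]
  · simp only
    rw [mul_comm j, Nat.mul_add_mod, Nat.mod_eq_of_lt hab, mul_comm a,
      Nat.mul_add_div (by omega), Nat.div_eq_of_lt hb, add_zero]
  · simp only
    rw [show j * (A * B) + (a * B + b) = B * (j * A + a) + b by ring, Nat.mul_add_mod,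
      Nat.mod_eq_of_lt hb]

end Digraph

/-! ### Choice of parameters and the final bounds -/

theorem exists_digraph_le_diameter {n D : ℕ} (hnD : (n : ℝ) ^ ((1 : ℝ) / 6) ≤ D)
    (hDn : D + 1 ≤ n) :
    ∃ G : Digraph (Fin n), ∀ H : Finset (Fin n × Fin n), G.IsShortcutSet H →
      (H.card : ℝ) ≤ 1 / 8192 * ((n : ℝ) / (D : ℝ)) ^ ((6 : ℝ) / 5) →
        (D : ℕ∞) ≤ (G.addEdges H).diameter := by
  have hn1 : (1 : ℝ) ≤ n := by exact_mod_cast (by omega : 1 ≤ n)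
  have hD1 : (1 : ℝ) ≤ D := le_trans (Real.one_le_rpow hn1 (by norm_num)) hnD
  have hD0 : 0 < D := by exact_mod_cast hD1
  have hn6 : n ≤ D ^ 6 := by
    have h := pow_le_pow_left₀ (by positivity) hnD 6
    rw [← Real.rpow_natCast, ← Real.rpow_mul (by positivity)] at h
    norm_num at h
    exact_mod_cast h
  set d := Nat.findGreatest (fun e => 24 * e ^ 5 * D ≤ n) n with hd
  have hdn : 24 * d ^ 5 * D ≤ n :=
    Nat.findGreatest_spec (P := fun e => 24 * e ^ 5 * D ≤ n) (Nat.zero_le n) (by simp)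
  have hdmax : n < 24 * (d + 1) ^ 5 * D := by
    by_contra! h
    have hle : d + 1 ≤ n := by
      have := Nat.le_self_pow (n := 5) (by norm_num) (d + 1)
      nlinarith
    have := Nat.le_findGreatest (P := fun e => 24 * e ^ 5 * D ≤ n) hle h
    omega
  have hup : ∀ z : ℕ, 24 * (d + 1) ^ 5 ≤ z ^ 5 →
      ((n : ℝ) / D) ^ ((6 : ℝ) / 5) < (z : ℝ) ^ 6 := by
    intro z hz
    have h1 : (n : ℝ) / D < (z : ℝ) ^ 5 := by
      rw [div_lt_iff₀ (by linarith)]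
      exact_mod_cast hdmax.trans_le (Nat.mul_le_mul_right D hz)
    have h2 := Real.rpow_lt_rpow (by positivity) h1 (by norm_num : (0 : ℝ) < 6 / 5)
    rwa [← Real.rpow_natCast, ← Real.rpow_mul (by positivity),
      show ((5 : ℕ) : ℝ) * (6 / 5) = ((6 : ℕ) : ℝ) by norm_num, Real.rpow_natCast] at h2
  rcases Nat.eq_zero_or_pos d with h0 | hpos
  · refine ⟨Digraph.finPath n, fun H _ hcard => ?_⟩
    -- Here `n / D < 24 < 2 ^ 5`, so the bound on `H.card` is below `2 ^ 6 / 8192 < 1` and a bare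
    -- path suffices.
    have h2 := hup 2 (by rw [h0]; norm_num)
    norm_num at h2
    have hH : (H.card : ℝ) < 1 := by linarith
    have hH : H = ∅ := Finset.card_eq_zero.1 (Nat.lt_one_iff.1 (by exact_mod_cast hH))
    subst hH
    exact Digraph.le_diameter_finPath hD0 (by omega)
  -- This is where `n ≤ D ^ 6` enters: it keeps the rounded length `k * d ≤ 2 * D + d` within `3 *
  -- D`, whence the factor 24 = 8 · 3.
  · have hdD : d ≤ D := by
      have h1 : d ^ 5 * D ≤ D ^ 5 * D := by
        have : D ^ 6 = D ^ 5 * D := by ring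
        nlinarith
      exact (Nat.pow_le_pow_iff_left (by norm_num)).1 (Nat.le_of_mul_le_mul_right h1 hD0)
    have hdiv := Nat.div_add_mod (2 * D) d
    have hmod := Nat.mod_lt (2 * D) hpos
    have hkd : (2 * D / d + 1) * d = d * (2 * D / d) + d := by ring
    obtain ⟨G, hG⟩ := Digraph.exists_fin_le_diameter (n := n) (d := d) (k := 2 * D / d + 1)
      (D := D) (Nat.succ_pos _) hpos (by omega) (by
        have : (2 * D / d + 1) * d ≤ 3 * D := by omega
        have := Nat.mul_le_mul_left (8 * d ^ 5) this
        nlinarith)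
    refine ⟨G, fun H hH hcard => hG H hH ?_⟩
    -- 24 · 2⁵ = 768 ≤ 4⁵, and 4⁶ = 8192 / 2 explains the constant.
    have h4 := hup (4 * d) (by
      have : (d + 1) ^ 5 ≤ (2 * d) ^ 5 := Nat.pow_le_pow_left (by omega) 5
      rw [mul_pow] at this ⊢
      omega)
    have : (2 * H.card : ℝ) ≤ (d : ℝ) ^ 6 := by
      push_cast at h4
      rw [mul_pow] at h4
      linarith
    exact_mod_cast this

theorem shortcutsSuffice_shortcutNumber {n D : ℕ} (hD : 0 < D) :
    ShortcutsSuffice n D (shortcutNumber n D) := by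
  refine Nat.sInf_mem (s := {s | ShortcutsSuffice n D s}) ⟨n * n, fun G => ?_⟩
  obtain ⟨H, hH, hdiam⟩ := G.exists_shortcutSet_diameter_le_one
  refine ⟨H, hH, ?_, hdiam.trans (by exact_mod_cast hD)⟩
  simpa using Finset.card_le_univ H

theorem theorem1p2 :
    ∃ c : ℝ, 0 < c ∧
      (∀ n D : ℕ, (n : ℝ) ^ ((1 : ℝ) / 6) ≤ (D : ℝ) → D + 1 ≤ n →
        ∃ G : Digraph (Fin n), ∀ H : Finset (Fin n × Fin n), G.IsShortcutSet H →
          (H.card : ℝ) ≤ c * ((n : ℝ) / (D : ℝ)) ^ ((6 : ℝ) / 5) →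
            (D : ℕ∞) ≤ (G.addEdges H).diameter) ∧
      (∀ n D : ℕ, (n : ℝ) ^ ((1 : ℝ) / 6) ≤ (D : ℝ) → D + 2 ≤ n →
        c * ((n : ℝ) / (D : ℝ)) ^ ((6 : ℝ) / 5) ≤ (shortcutNumber n D : ℝ)) := by
  refine ⟨1 / 32768, by norm_num, fun n D hnD hDn => ?_, fun n D hnD hDn => ?_⟩
  · obtain ⟨G, hG⟩ := exists_digraph_le_diameter hnD hDn
    refine ⟨G, fun H hH hcard => hG H hH (hcard.trans ?_)⟩
    exact mul_le_mul_of_nonneg_right (by norm_num) (by positivity)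
  · have hn1 : (1 : ℝ) ≤ n := by exact_mod_cast (by omega : 1 ≤ n)
    have hD1 : (1 : ℝ) ≤ D := le_trans (Real.one_le_rpow hn1 (by norm_num)) hnD
    -- Diameter at least `D + 1` contradicts diameter at most `D`; passing from `D` to `D + 1` costs
    -- a factor 4 in the constant.
    obtain ⟨G, hG⟩ := exists_digraph_le_diameter (n := n) (D := D + 1)
      (by push_cast; linarith) hDn
    obtain ⟨H, hH, hcard, hdiam⟩ :=
      shortcutsSuffice_shortcutNumber (n := n) (D := D) (by exact_mod_cast hD1) G
    by_contra! hlt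
    have hhalf : ((n : ℝ) / D) ^ ((6 : ℝ) / 5) ≤
        4 * ((n : ℝ) / ((D + 1 : ℕ) : ℝ)) ^ ((6 : ℝ) / 5) := by
      have h1 : (n : ℝ) / D ≤ 2 * ((n : ℝ) / ((D + 1 : ℕ) : ℝ)) := by
        push_cast
        rw [← mul_div_assoc, div_le_div_iff₀ (by linarith) (by linarith)]
        nlinarith
      refine (Real.rpow_le_rpow (by positivity) h1 (by norm_num)).trans ?_
      rw [Real.mul_rpow (by norm_num) (by positivity)]
      refine mul_le_mul_of_nonneg_right ?_ (by positivity)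
      calc (2 : ℝ) ^ ((6 : ℝ) / 5) ≤ (2 : ℝ) ^ (2 : ℝ) :=
            Real.rpow_le_rpow_of_exponent_le (by norm_num) (by norm_num)
        _ = 4 := by norm_num
    have hle : (H.card : ℝ) ≤ shortcutNumber n D := by exact_mod_cast hcard
    have h := (hG H hH (by linarith)).trans hdiam
    have h : D + 1 ≤ D := by exact_mod_cast h
    omega
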